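/- Let $K$ be a field and let $T=K[x_1,\dots,x_n]$ carry a standard $\mathbb Z^u$-grading, i.e. $\deg x_j\in\{e_1,\dots,e_u\}$ for every $j$. Let $S=T[y_1,\dots,y_u]=K[x_1,\dots,x_n,y_1,\dots,y_u]$. For $0\ne f=\sum_i\lambda_i x^{a_i}\in T$ (with distinct monomials and all $\lambda_i\neq 0$), put $f^{\hom}=\sum_i\lambda_i x^{a_i}y^{b-b_i}\in S$, where $b_i=\deg x^{a_i}\in\mathbb Z^u$ and $b$ is the componentwise maximum of the $b_i$. For an ideal $I$ of $T$, let $I^{\hom}\subseteq S$ be the ideal generated by all $f^{\hom}$ with $f\in I\setminus\{0\}$, and let $I^{\star}\subseteq T$ be the ideal generated by the $\mathbb Z^u$-homogeneous elements of $I$, that is, the largest $\mathbb Z^u$-graded ideal contained in $I$. Let $V$ be a $K$-vector space of linear forms of $T$ (forms of total degree $1$) and let $J(V)$ be the ideal of $T$ generated by $V$. For every nonempty subset $A=\{a_1<\dots<a_k\}$ of $[u]=\{1,\dots,u\}$ put $V_A=V\cap\bigoplus_{i\in A}T_{e_i}$, choose a finite generating family $L_1,\dots,L_v$ of the vector space $V_A$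 (where $v$ and the $L_i$ depend on $A$), and let $M_A$ be the $k\times v$ matrix over $T$ whose $(p,i)$ entry is the homogeneous component of $L_i$ of degree $e_{a_p}$. Let $Y_A$ be the $k\times(k-1)$ matrix over $S$ whose $j$-th column has $y_{a_j}$ in row $j$, $-y_{a_{j+1}}$ in row $j+1$ and zeros elsewhere, and let $X_A=(Y_A\mid M_A)$ be the resulting $k\times(k-1+v)$ matrix over $S$. For a matrix $N$ denote by $I_t(N)$ the ideal generated by the $t$-minors of $N$ (the zero ideal if there are none). Then, for any choice of these generating families, $$J(V)^{\hom}=\sum_{\emptyset\neq A\subseteq[u]}I_{|A|}(X_A)\qquad\text{and}\qquad J(V)^{\star}=\sum_{\emptyset\neq A\subseteq[u]}I_{|A|}(M_A).$$ -/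

import Mathlib

open MvPolynomial

noncomputable section

namespace MultiHom

/-- The multidegrees `deg x_j = e_{d j}` of the variables in a standard multigraded structure:
each variable has one of the standard basis vectors as its degree. -/
def varDeg {n u : ℕ} (d : Fin n → Fin u) (j : Fin n) : Fin u →₀ ℕ :=
  Finsupp.single (d j) 1

/-- The graded component `T_b` of `T = K[x_1, …, x_n]`, for the grading `deg x_j = e_{d j}`. -/
abbrev gradedPiece (K : Type*) [Field K] {n u : ℕ} (d : Fin n → Fin u) (b : Fin u →₀ ℕ) :
    Submodule K (MvPolynomial (Fin n) K) :=
  weightedHomogeneousSubmodule K (varDeg d) b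

/-- The exponent `b` with `y^b = lcm (y^{b_1}, …, y^{b_v})`, the `b_i` being the multidegrees of
the monomials in the support of `f`; that is, their componentwise maximum. -/
def lcmDeg {K : Type*} [Field K] {n u : ℕ} (d : Fin n → Fin u) (f : MvPolynomial (Fin n) K) :
    Fin u →₀ ℕ :=
  f.support.sup (fun a => Finsupp.weight (varDeg d) a)

/-- The homogenization `f^hom = ∑ λ_a x^a y^{b - deg x^a}` in `S = K[x_1, …, x_n, y_1, …, y_u]`.
The variable `x_j` of `S` is `X (Sum.inl j)` and `y_i` is `X (Sum.inr i)`.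
Each `deg x^a` is at most `b`, so the subtraction does not truncate. -/
def homogenize {K : Type*} [Field K] {n u : ℕ} (d : Fin n → Fin u)
    (f : MvPolynomial (Fin n) K) : MvPolynomial (Fin n ⊕ Fin u) K :=
  ∑ a ∈ f.support,
    rename Sum.inl (monomial a (coeff a f)) *
      rename Sum.inr (monomial (lcmDeg d f - Finsupp.weight (varDeg d) a) (1 : K))

/-- The homogenization `I^hom = (f^hom : f ∈ I, f ≠ 0)` of an ideal `I` of `T`. -/
def homIdeal {K : Type*} [Field K] {n u : ℕ} (d : Fin n → Fin u)
    (I : Ideal (MvPolynomial (Fin n) K)) : Ideal (MvPolynomial (Fin n ⊕ Fin u) K) :=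
  Ideal.span {F | ∃ f ∈ I, f ≠ 0 ∧ F = homogenize d f}

/-- `I^⋆`: the largest multigraded ideal of `T` contained in `I`, which is the ideal generated by
the multihomogeneous elements of `I`. -/
def starIdeal {K : Type*} [Field K] {n u : ℕ} (d : Fin n → Fin u)
    (I : Ideal (MvPolynomial (Fin n) K)) : Ideal (MvPolynomial (Fin n) K) :=
  I.homogeneousCore' (gradedPiece K d)

/-- `J(V)`, the ideal of `T` generated by `V`. -/
def linIdeal {K : Type*} [Field K] {n : ℕ} (V : Submodule K (MvPolynomial (Fin n) K)) :
    Ideal (MvPolynomial (Fin n) K) :=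
  Ideal.span (V : Set (MvPolynomial (Fin n) K))

/-- `V_A = V ∩ ⨁_{i ∈ A} T_{e_i}`. -/
def subspaceOn {K : Type*} [Field K] {n u : ℕ} (d : Fin n → Fin u)
    (V : Submodule K (MvPolynomial (Fin n) K)) (A : Finset (Fin u)) :
    Submodule K (MvPolynomial (Fin n) K) :=
  V ⊓ ⨆ i ∈ A, gradedPiece K d (Finsupp.single i 1)

/-- `I_t(M)`: the ideal generated by the `t`-minors of `M`. It is zero when there are none. -/
def minorIdeal {R ι κ : Type*} [CommRing R] (t : ℕ) (M : Matrix ι κ R) : Ideal R :=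
  Ideal.span {m | ∃ (r : Fin t ↪ ι) (c : Fin t ↪ κ), m = (M.submatrix r c).det}

/-- The matrix `M_A` of linear forms `L_1, …, L_v`: writing `A = {a_1 < ⋯ < a_k}`, its `(p, i)`
entry is the homogeneous component of `L_i` of degree `e_{a_p}`. -/
def matM {K : Type*} [Field K] {n u v : ℕ} (d : Fin n → Fin u) (A : Finset (Fin u))
    (L : Fin v → MvPolynomial (Fin n) K) :
    Matrix (Fin A.card) (Fin v) (MvPolynomial (Fin n) K) :=
  Matrix.of fun p i =>
    weightedHomogeneousComponent (varDeg d) (Finsupp.single (A.orderEmbOfFin rfl p) 1) (L i)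

/-- The bidiagonal `k × (k - 1)` matrix `Y_A`, for `A = {a_1 < ⋯ < a_k}`: its `j`-th column has
`y_{a_j}` in row `j`, `-y_{a_{j+1}}` in row `j + 1` and zeros elsewhere. -/
def matY (K : Type*) [Field K] (n : ℕ) {u : ℕ} (A : Finset (Fin u)) :
    Matrix (Fin A.card) (Fin (A.card - 1)) (MvPolynomial (Fin n ⊕ Fin u) K) :=
  Matrix.of fun p j =>
    if (p : ℕ) = (j : ℕ) then X (Sum.inr (A.orderEmbOfFin rfl p))
    else if (p : ℕ) = (j : ℕ) + 1 then -X (Sum.inr (A.orderEmbOfFin rfl p))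
    else 0

/-- The block matrix `X_A = (Y_A | M_A)` over `S`. -/
def matX {K : Type*} [Field K] {n u v : ℕ} (d : Fin n → Fin u) (A : Finset (Fin u))
    (L : Fin v → MvPolynomial (Fin n) K) :
    Matrix (Fin A.card) (Fin (A.card - 1) ⊕ Fin v) (MvPolynomial (Fin n ⊕ Fin u) K) :=
  Matrix.fromCols (matY K n A) ((matM d A L).map (rename Sum.inl))

end MultiHom

end

/-! Both equalities rest on `mem_detIdeal`: when every variable has a standard basis vector as
degree, a multihomogeneous element of the ideal (V) generated by a space V of linear forms is a
combination of determinants of square matrices whose rows consist of forms of distinct degrees and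
whose column sums lie in V. Conversely such determinants lie in (V) (`det_mem_of_sum_mem`).

For J(V)^⋆ this is applied in T. A column of forms of degrees e_a, a ∈ A, with sum in V lists the
components of an element of V_A, so it is a combination of columns of M_A. For J(V)^hom it is
applied in S, with deg y_i = e_i and V enlarged by the differences y_i - y_j: each f^hom lies in the
ideal of the enlarged space, and the differences account for the columns of Y_A. Conversely, the
minors of X_A are multihomogeneous, and putting all y_i = 1 sends them into J(V); this suffices by
`mem_homIdeal`.

Over an infinite field `mem_detIdeal` follows from `mem_relSpan`, which treats products of spaces of
linear forms by induction on the number of factors. Let f ∈ (V) lie in D · E.prod with D inside the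
first factor, and let D' be a general hyperplane of D. Then f = x g + (an element of D' · E.prod),
and g ∈ (V + D') because that ideal is prime and does not contain x. By induction g comes from
relations modulo V + D'; bordering them turns x g into relations modulo V, up to D' · E.prod, and D
has shrunk. Repeated degrees are removed by a row operation, and the algebraic closure takes care of
finite fields. -/

noncomputable section

namespace MultiHom

section

/-! ### Determinants and ideals -/

section Det

variable {R : Type*} [CommRing R]

/-- Modulo `I` the row vector of ones annihilates the matrix; multiplying by the adjugate gives `det
= 0`. The empty matrix, of determinant 1, has to be excluded. -/
lemma det_mem_of_sum_mem {k : ℕ} [NeZero k] (I : Ideal R) (M : Matrix (Fin k) (Fin k) R)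
    (h : ∀ j, ∑ i, M i j ∈ I) : M.det ∈ I := by
  rw [← Ideal.Quotient.eq_zero_iff_mem, RingHom.map_det]
  set N := (Ideal.Quotient.mk I).mapMatrix M with hN
  have h1 : Matrix.vecMul 1 N = 0 := by
    ext j
    simp only [Matrix.vecMul, dotProduct, Pi.one_apply, one_mul, Pi.zero_apply, hN,
      RingHom.mapMatrix_apply, Matrix.map_apply]
    rw [← map_sum, Ideal.Quotient.eq_zero_iff_mem]
    exact h j
  have h2 := congrArg (fun x => Matrix.vecMul x N.adjugate) h1
  simp only [Matrix.vecMul_vecMul, Matrix.mul_adjugate, Matrix.vecMul_smul, Matrix.vecMul_one,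
    Matrix.zero_vecMul] at h2
  simpa using congrFun h2 0

/-- If every row of `M` is a combination of vectors in `C`, and all matrices with rows in `C` have
determinant in `I`, then so has `M`. -/
lemma det_mem_of_rows_mem_span {k : ℕ} (I : Ideal R) (C : Set (Fin k → R))
    (hC : ∀ N : Matrix (Fin k) (Fin k) R, (∀ i, N i ∈ C) → N.det ∈ I)
    (M : Matrix (Fin k) (Fin k) R) (hM : ∀ i, M i ∈ Submodule.span R C) : M.det ∈ I := by
  -- Here `s` collects the rows still to be expanded; multilinearity removes them one at a time.
  suffices H : ∀ s : Finset (Fin k), ∀ N : Matrix (Fin k) (Fin k) R,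
      (∀ i ∈ s, N i ∈ Submodule.span R C) → (∀ i ∉ s, N i ∈ C) → N.det ∈ I from
    H Finset.univ M (fun i _ => hM i) (fun i hi => absurd (Finset.mem_univ i) hi)
  intro s
  induction s using Finset.induction_on with
  | empty => exact fun N _ h => hC N fun i => h i (Finset.notMem_empty i)
  | insert a s ha ih =>
    intro N h1 h2
    have key : ∀ x ∈ Submodule.span R C, (N.updateRow a x).det ∈ I := by
      intro x hx
      induction hx using Submodule.span_induction with
      | mem x hx =>
        refine ih _ (fun i hi => ?_) (fun i hi => ?_)
        · have : i ≠ a := fun h => ha (h ▸ hi)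
          rw [Matrix.updateRow_ne this]
          exact h1 i (Finset.mem_insert_of_mem hi)
        · by_cases hia : i = a
          · subst hia; rwa [Matrix.updateRow_self]
          · rw [Matrix.updateRow_ne hia]
            exact h2 i (by simp [hia, hi])
      | zero => rw [Matrix.det_eq_zero_of_row_eq_zero a (by simp)]; exact I.zero_mem
      | add x y _ _ hx hy => rw [Matrix.det_updateRow_add]; exact I.add_mem hx hy
      | smul c x _ hx => rw [Matrix.det_updateRow_smul]; exact I.mul_mem_left _ hx
    simpa using key (N a) (h1 a (Finset.mem_insert_self a s))

end Det

/-! ### Ideals generated by linear forms are prime -/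

section Prime

variable {σ K : Type*} [Field K]

/-- Modulo an ideal generated by linear forms, a polynomial ring is again a polynomial ring; here
the quotient map is followed by a section. -/
lemma exists_algHom_ker_span (V : Submodule K (MvPolynomial σ K))
    (hV : V ≤ homogeneousSubmodule σ K 1) :
    ∃ π : MvPolynomial σ K →ₐ[K] MvPolynomial σ K,
      (∀ f, f ∈ Ideal.span (V : Set (MvPolynomial σ K)) ↔ π f = 0) ∧
        ∀ l ∈ homogeneousSubmodule σ K 1, π l = 0 → l ∈ V := by
  -- The complement is taken in the whole polynomial ring, which is harmless: `p` moves each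
  -- variable only by an element of `V`.
  obtain ⟨C, hC⟩ := Submodule.exists_isCompl V
  set p : MvPolynomial σ K →ₗ[K] MvPolynomial σ K := C.projection V hC.symm with hp
  have hker : ∀ x, p x = 0 ↔ x ∈ V := fun x => by
    rw [hp, Submodule.projection_apply_eq_zero_iff]
  have hsub : ∀ x, x - p x ∈ V := Submodule.sub_projection_mem hC.symm
  have hlin : ∀ l ∈ homogeneousSubmodule σ K 1, aeval (fun j => p (X j)) l = p l := by
    intro l hl
    rw [homogeneousSubmodule_one_eq_span_X] at hl
    induction hl using Submodule.span_induction with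
    | mem x hx => obtain ⟨j, rfl⟩ := hx; simp
    | zero => simp
    | add x y _ _ hx hy => rw [map_add, map_add, hx, hy]
    | smul c x _ hx => rw [map_smul, map_smul, hx]
  refine ⟨aeval (fun j => p (X j)), fun f => ⟨fun hf => ?_, fun hf => ?_⟩, fun l hl h => ?_⟩
  · refine (Ideal.span_le (I := RingHom.ker (aeval (R := K) (fun j : σ => p (X j))))).2 ?_ hf
    intro l hl
    simp only [SetLike.mem_coe, RingHom.mem_ker]
    rw [hlin l (hV hl), hker]
    exact hl
  · have hgen : ∀ g : MvPolynomial σ K,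
        g - aeval (fun j => p (X j)) g ∈ Ideal.span (V : Set (MvPolynomial σ K)) := by
      intro g
      rw [← Ideal.Quotient.eq_zero_iff_mem, map_sub, sub_eq_zero]
      have : (Ideal.Quotient.mkₐ K (Ideal.span (V : Set (MvPolynomial σ K)))) =
          (Ideal.Quotient.mkₐ K (Ideal.span (V : Set (MvPolynomial σ K)))).comp
            (aeval (fun j => p (X j))) := by
        ext j
        simp only [AlgHom.comp_apply, aeval_X]
        rw [← sub_eq_zero, ← map_sub]
        exact Ideal.Quotient.eq_zero_iff_mem.2 (Ideal.subset_span (hsub _))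
      exact DFunLike.congr_fun this g
    rw [← sub_zero f, ← hf]
    exact hgen f
  · rwa [hlin l hl, hker] at h

/-- The quotient embeds into a polynomial ring, hence is a domain, and a linear form outside `V`
stays nonzero in it. -/
lemma mem_span_of_mul_mem (V : Submodule K (MvPolynomial σ K))
    (hV : V ≤ homogeneousSubmodule σ K 1) {x g : MvPolynomial σ K}
    (hx : x ∈ homogeneousSubmodule σ K 1) (hxV : x ∉ V)
    (h : x * g ∈ Ideal.span (V : Set (MvPolynomial σ K))) :
    g ∈ Ideal.span (V : Set (MvPolynomial σ K)) := by
  obtain ⟨π, h1, h2⟩ := exists_algHom_ker_span V hV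
  rw [h1, map_mul, mul_eq_zero] at h
  exact (h1 g).2 (h.resolve_left fun h => hxV (h2 x hx h))

end Prime

/-! ### Determinants of relations among members of a multiset of spaces -/

section RelSpan

variable {K R : Type*} [Field K] [CommRing R] [Algebra K R]

/-- The span of the products of a determinant, whose columns are relations modulo `V` between
members of `E`, with elements of the remaining members of `E`. -/
def relSpan (E : Multiset (Submodule K R)) (V : Submodule K R) : Submodule K R :=
  Submodule.span K {z | ∃ (k : ℕ) (F : Fin (k + 1) → Submodule K R) (G : Multiset (Submodule K R))
    (M : Matrix (Fin (k + 1)) (Fin (k + 1)) R) (h : R),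
    E = (List.ofFn F : Multiset (Submodule K R)) + G ∧ (∀ i j, M i j ∈ F i) ∧
      (∀ j, ∑ i, M i j ∈ V) ∧ h ∈ G.prod ∧ z = M.det * h}

lemma relSpan_le (E : Multiset (Submodule K R)) (V : Submodule K R) {z : R}
    (hz : z ∈ relSpan E V) : z ∈ Ideal.span (V : Set R) := by
  induction hz using Submodule.span_induction with
  | mem z hz =>
    obtain ⟨k, F, G, M, h, -, -, h3, -, rfl⟩ := hz
    exact Ideal.mul_mem_right _ _ (det_mem_of_sum_mem _ _ fun j => Ideal.subset_span (h3 j))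
  | zero => exact Ideal.zero_mem _
  | add x y _ _ hx hy => exact Ideal.add_mem _ hx hy
  | smul c x _ hx => rw [Algebra.smul_def]; exact Ideal.mul_mem_left _ _ hx

lemma prod_mem_prod_submodule {ι : Type*} (s : Finset ι) (F : ι → Submodule K R) (x : ι → R)
    (h : ∀ i ∈ s, x i ∈ F i) : ∏ i ∈ s, x i ∈ ∏ i ∈ s, F i := by
  classical
  induction s using Finset.induction_on with
  | empty => exact ⟨1, by simp⟩
  | insert a s ha ih =>
    rw [Finset.prod_insert ha, Finset.prod_insert ha]
    exact Submodule.mul_mem_mul (h a (Finset.mem_insert_self a s))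
      (ih fun i hi => h i (Finset.mem_insert_of_mem hi))

lemma det_mem_prod {k : ℕ} (F : Fin k → Submodule K R) (M : Matrix (Fin k) (Fin k) R)
    (h : ∀ i j, M i j ∈ F i) : M.det ∈ (List.ofFn F : Multiset (Submodule K R)).prod := by
  rw [Multiset.prod_coe, List.prod_ofFn, ← Matrix.det_transpose, Matrix.det_apply]
  refine Submodule.sum_mem _ fun s _ => ?_
  have : ∏ i, Matrix.transpose M (s i) i ∈ ∏ i, F i :=
    prod_mem_prod_submodule _ _ _ fun i _ => h _ _
  rw [Units.smul_def]
  exact zsmul_mem this _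

lemma mem_sum_ofFn {k : ℕ} (F : Fin k → Submodule K R) {x : R}
    (hx : x ∈ (List.ofFn F : Multiset (Submodule K R)).sum) :
    ∃ N : Fin k → R, (∀ i, N i ∈ F i) ∧ ∑ i, N i = x := by
  rw [Multiset.sum_coe, List.sum_ofFn] at hx
  induction k generalizing x with
  | zero => simp at hx; exact ⟨0, fun i => i.elim0, by simp [hx]⟩
  | succ k ih =>
    rw [Fin.sum_univ_succ, Submodule.add_eq_sup, Submodule.mem_sup] at hx
    obtain ⟨y, hy, z, hz, rfl⟩ := hx
    obtain ⟨N, hN, rfl⟩ := ih _ hz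
    refine ⟨Fin.cons y N, fun i => ?_, by simp [Fin.sum_univ_succ]⟩
    cases i using Fin.cases with
    | zero => simpa
    | succ i => simpa using hN i

end RelSpan

end

/-! ### Bordering, and the kernel of multiplication over an infinite field -/

section

section Border

variable {K R : Type*} [Field K] [CommRing R] [Algebra K R]

/-- A relation of `V ⊔ D'` among members of `E` can be bordered to one of `V` among `D` and `E`,
as soon as `D'` is in sufficiently general position. -/
lemma exists_relSpan_sub_mem (E : Multiset (Submodule K R)) (V D E₁ : Submodule K R)
    (hDE : D ≤ E₁) (φ : R →ₗ[K] K)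
    (hgen : ∀ A ≤ E, D ⊓ (A.sum ⊔ V) ≤ V ∨ ∃ w ∈ D ⊓ (A.sum ⊔ V), φ w ≠ 0)
    {x : R} (hx : x ∈ D) {g : R} (hg : g ∈ relSpan E (V ⊔ (D ⊓ LinearMap.ker φ))) :
    ∃ q ∈ relSpan (E₁ ::ₘ E) V, x * g - q ∈ (D ⊓ LinearMap.ker φ) * E.prod := by
  induction hg using Submodule.span_induction with
  | zero => exact ⟨0, Submodule.zero_mem _, by simp⟩
  | add a b _ _ ha hb =>
    obtain ⟨p, hp, hp'⟩ := ha
    obtain ⟨q, hq, hq'⟩ := hb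
    refine ⟨p + q, Submodule.add_mem _ hp hq, ?_⟩
    convert Submodule.add_mem _ hp' hq' using 1
    ring
  | smul c a _ ha =>
    obtain ⟨p, hp, hp'⟩ := ha
    refine ⟨c • p, Submodule.smul_mem _ c hp, ?_⟩
    convert Submodule.smul_mem _ c hp' using 1
    rw [mul_smul_comm, smul_sub]
  | mem g hg =>
    obtain ⟨k, F, G, M, h, rfl, hM, hV, hh, rfl⟩ := hg
    choose v hv e he hve using fun j => Submodule.mem_sup.1 (hV j)
    -- The errors `e j` lie in `D` and in the sum of the `F i` and `V`. In the first case they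
    -- therefore lie in `V`, so `M` already consists of relations modulo `V` and `x` joins the
    -- cofactor `h`.
    rcases hgen (List.ofFn F : Multiset (Submodule K R)) (Multiset.le_add_right _ _) with hA | hA
    · refine ⟨x * (M.det * h), Submodule.subset_span
        ⟨k, F, E₁ ::ₘ G, M, x * h, ?_, hM, fun j => ?_, ?_, by ring⟩, by simp⟩
      · rw [Multiset.add_cons]
      · have h1 : e j ∈ V := by
          refine hA ⟨(he j).1, ?_⟩
          have h2 : e j = ∑ i, M i j + -(v j) := by rw [← hve]; ring
          rw [h2]
          refine Submodule.add_mem_sup ?_ (Submodule.neg_mem _ (hv j))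
          rw [Multiset.sum_coe, List.sum_ofFn]
          exact Submodule.sum_mem _ fun i hi =>
            (Finset.single_le_sum (f := F) (fun _ _ => zero_le) hi) (hM i j)
        rw [← hve]
        exact V.add_mem (hv j) h1
      · rw [Multiset.prod_cons]
        exact Submodule.mul_mem_mul (hDE hx) hh
    · obtain ⟨w, ⟨hwD, hw⟩, hφw⟩ := hA
      -- This scalar puts `x - c • w` into `ker φ`.
      set c := φ x / φ w with hc
      obtain ⟨s, hs, t, ht, hst⟩ := Submodule.mem_sup.1 hw
      obtain ⟨N, hN, rfl⟩ := mem_sum_ofFn F hs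
      -- The new row cancels the errors `e j`; the new column sums to `c • t`, which lies in `V`.
      set P : Matrix (Fin (k + 2)) (Fin (k + 2)) R :=
        Fin.cons (Fin.cons (c • w) (fun j => -e j)) (fun i => Fin.cons (-(c • N i)) (M i))
      refine ⟨P.det * h, Submodule.subset_span
        ⟨k + 1, Fin.cons E₁ F, G, P, h, ?_, ?_, ?_, hh, rfl⟩, ?_⟩
      · rw [List.ofFn_cons, ← Multiset.cons_coe, Multiset.cons_add]
      · intro i j
        cases i using Fin.cases with
        | zero =>
          cases j using Fin.cases with
          | zero => exact hDE (D.smul_mem _ hwD)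
          | succ j => exact Submodule.neg_mem _ (hDE (he j).1)
        | succ i =>
          cases j using Fin.cases with
          | zero => exact Submodule.neg_mem _ (Submodule.smul_mem _ _ (hN i))
          | succ j => exact hM i j
      · intro j
        rw [Fin.sum_univ_succ]
        cases j using Fin.cases with
        | zero =>
          have : c • w + ∑ i, -(c • N i) ∈ V := by
            rw [Finset.sum_neg_distrib, ← Finset.smul_sum, ← hst, smul_add]
            simpa using V.smul_mem c ht
          exact this
        | succ j =>
          have : -e j + ∑ i, M i j ∈ V := by
            rw [← hve]
            simpa using hv j
          exact this
      · have hdet : P.det = (c • w) * M.det +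
            ∑ j : Fin (k + 1), (-1) ^ (j.succ : ℕ) * (-e j) *
              (P.submatrix Fin.succ j.succ.succAbove).det := by
          rw [Matrix.det_succ_row_zero, Fin.sum_univ_succ]
          congr 1
          simp only [Fin.val_zero, pow_zero, one_mul]
          rfl
        have hsub : ∀ (j : Fin (k + 1)) (a : ℕ), (-1) ^ a * (-e j) *
              (P.submatrix Fin.succ j.succ.succAbove).det * h ∈
              (D ⊓ LinearMap.ker φ) * ((List.ofFn F : Multiset (Submodule K R)) + G).prod := by
          intro j a
          rw [mul_assoc, Multiset.prod_add]
          refine Submodule.mul_mem_mul ?_ (Submodule.mul_mem_mul (det_mem_prod F _ ?_) hh)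
          · rcases neg_one_pow_eq_or R a with h' | h' <;> rw [h'] <;>
              simpa using he j
          · intro i l
            change (Fin.cons (-(c • N i)) (M i) : Fin (k + 2) → R) (j.succ.succAbove l) ∈ F i
            cases j.succ.succAbove l using Fin.cases with
            | zero => exact Submodule.neg_mem _ (Submodule.smul_mem _ _ (hN i))
            | succ j => exact hM i j
        have hxw : x - c • w ∈ D ⊓ LinearMap.ker φ := by
          refine ⟨D.sub_mem hx (D.smul_mem _ hwD), ?_⟩
          rw [SetLike.mem_coe, LinearMap.mem_ker, map_sub, map_smul, smul_eq_mul, hc, div_mul_cancel₀ _ hφw, sub_self]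
        have : x * (M.det * h) - P.det * h = (x - c • w) * (M.det * h) -
            ∑ j : Fin (k + 1), (-1) ^ (j.succ : ℕ) * (-e j) *
              (P.submatrix Fin.succ j.succ.succAbove).det * h := by
          rw [hdet, add_mul, Finset.sum_mul]; ring
        rw [this]
        refine Submodule.sub_mem _ (Submodule.mul_mem_mul hxw ?_)
          (Submodule.sum_mem _ fun j _ => hsub j _)
        rw [Multiset.prod_add]
        exact Submodule.mul_mem_mul (det_mem_prod F M hM) hh

/-- There are only finitely many `A ≤ E`. One vector outside `V` is picked in each relevant space,
and over an infinite field some functional on `R ⧸ V` is nonzero at all of them. -/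
lemma exists_functional [Infinite K] (E : Multiset (Submodule K R)) (V D : Submodule K R)
    (hD : ¬ D ≤ V) : ∃ φ : R →ₗ[K] K, V ≤ LinearMap.ker φ ∧ (∃ x ∈ D, φ x ≠ 0) ∧
      ∀ A ≤ E, D ⊓ (A.sum ⊔ V) ≤ V ∨ ∃ w ∈ D ⊓ (A.sum ⊔ V), φ w ≠ 0 := by
  classical
  let B : Finset (Submodule K R) :=
    (insert D (E.powerset.map fun A => D ⊓ (A.sum ⊔ V)).toFinset).filter fun W => ¬ W ≤ V
  have hB : ∀ W : B, ∃ w ∈ W.1, w ∉ V := fun W =>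
    SetLike.not_le_iff_exists.1 (Finset.mem_filter.1 W.2).2
  choose w hw hwV using hB
  obtain ⟨f, hf⟩ := Module.exists_dual_forall_apply_ne_zero (K := K) (fun W : B => V.mkQ (w W))
    (fun W => by simpa using hwV W)
  have key : ∀ W ∈ B, ∃ x ∈ W, (f ∘ₗ V.mkQ) x ≠ 0 := fun W hW => ⟨w ⟨W, hW⟩, hw ⟨W, hW⟩, hf ⟨W, hW⟩⟩
  refine ⟨f ∘ₗ V.mkQ, fun x hx => ?_, key D ?_, fun A hA => ?_⟩
  · have : V.mkQ x = 0 := by simpa using hx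
    rw [LinearMap.mem_ker, LinearMap.comp_apply, this, map_zero]
  · simp [B, hD]
  · by_cases h : D ⊓ (A.sum ⊔ V) ≤ V
    · exact Or.inl h
    · refine Or.inr (key _ ?_)
      rw [Finset.mem_filter]
      refine ⟨Finset.mem_insert_of_mem ?_, h⟩
      rw [Multiset.mem_toFinset, Multiset.mem_map]
      exact ⟨A, Multiset.mem_powerset.2 hA, rfl⟩

end Border

variable {σ K : Type*} [Field K]

/-- Inner induction, on the dimension of `D`: each step replaces `D` by a general hyperplane `D'`,
and `f` by its difference with an element of `relSpan`. -/
lemma mem_relSpan_of_mem_mul [Infinite K] (E : Multiset (Submodule K (MvPolynomial σ K)))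
    (E₁ V : Submodule K (MvPolynomial σ K)) (hV : V ≤ homogeneousSubmodule σ K 1)
    (hE₁ : E₁ ≤ homogeneousSubmodule σ K 1)
    (ih : ∀ V' : Submodule K (MvPolynomial σ K), V' ≤ homogeneousSubmodule σ K 1 →
      ∀ g ∈ E.prod, g ∈ Ideal.span (V' : Set (MvPolynomial σ K)) → g ∈ relSpan E V')
    (D : Submodule K (MvPolynomial σ K)) [FiniteDimensional K D] (hD : D ≤ E₁)
    {f : MvPolynomial σ K}
    (hf : f ∈ D * E.prod) (hfV : f ∈ Ideal.span (V : Set (MvPolynomial σ K))) :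
    f ∈ relSpan (E₁ ::ₘ E) V := by
  induction hn : Module.finrank K D using Nat.strong_induction_on generalizing D f with
  | _ n hrec =>
  by_cases hDV : D ≤ V
  -- Elements of `D ≤ V` are themselves relations, of size 1.
  · refine (Submodule.mul_le (P := relSpan (E₁ ::ₘ E) V)).2 (fun m hm g hg => ?_) hf
    refine Submodule.subset_span ⟨0, ![E₁], E, !![m], g, ?_, ?_, ?_, hg, by simp⟩
    · rfl
    · intro i j
      fin_cases i; fin_cases j
      exact hD hm
    · intro j
      fin_cases j
      simpa using hDV hm
  obtain ⟨φ, hφV, ⟨x, hx, hφx⟩, hgen⟩ := exists_functional E V D hDV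
  set D' := D ⊓ LinearMap.ker φ with hD'
  have hD'D : D' ≤ D := inf_le_left
  -- Since `φ x ≠ 0`, the space `D` is the sum of `D'` and the line through `x`.
  have hdec : ∃ g ∈ E.prod, f - x * g ∈ D' * E.prod := by
    refine Submodule.mul_induction_on hf (fun m hm g hg => ?_) (fun a b ha hb => ?_)
    · refine ⟨(φ m / φ x) • g, Submodule.smul_mem _ _ hg, ?_⟩
      have : m * g - x * (φ m / φ x) • g = (m - (φ m / φ x) • x) * g := by
        rw [sub_mul, mul_smul_comm, smul_mul_assoc]
      rw [this]
      refine Submodule.mul_mem_mul ⟨D.sub_mem hm (D.smul_mem _ hx), ?_⟩ hg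
      rw [SetLike.mem_coe, LinearMap.mem_ker, map_sub, map_smul, smul_eq_mul, div_mul_cancel₀ _ hφx, sub_self]
    · obtain ⟨g, hg, hg'⟩ := ha
      obtain ⟨l, hl, hl'⟩ := hb
      refine ⟨g + l, Submodule.add_mem _ hg hl, ?_⟩
      convert Submodule.add_mem _ hg' hl' using 1
      ring
  obtain ⟨g, hg, hfg⟩ := hdec
  have hV' : V ⊔ D' ≤ homogeneousSubmodule σ K 1 := sup_le hV (hD'D.trans (hD.trans hE₁))
  have hxV' : x ∉ V ⊔ D' := by
    intro h
    have : V ⊔ D' ≤ LinearMap.ker φ := sup_le hφV inf_le_right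
    exact hφx (this h)
  have hD'mul : ∀ z ∈ D' * E.prod, z ∈ Ideal.span ((V ⊔ D' : Submodule K (MvPolynomial σ K)) :
      Set (MvPolynomial σ K)) := by
    intro z hz
    refine Submodule.mul_induction_on hz (fun m hm l _ => ?_) (fun a b ha hb => Ideal.add_mem _ ha hb)
    exact Ideal.mul_mem_right _ _ (Ideal.subset_span (Submodule.mem_sup_right hm))
  have hgV' := mem_span_of_mul_mem (V ⊔ D') hV' (hE₁ (hD hx)) hxV' (g := g) (by
    have h1 := hD'mul _ hfg
    have h2 := Ideal.span_mono (show (V : Set (MvPolynomial σ K)) ⊆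
      ((V ⊔ D' : Submodule K (MvPolynomial σ K)) : Set _) from
      (le_sup_left : V ≤ V ⊔ D')) hfV
    simpa using Ideal.sub_mem _ h2 h1)
  obtain ⟨q, hq, hq'⟩ := exists_relSpan_sub_mem E V D E₁ hD φ hgen hx (ih _ hV' g hg hgV')
  have hlt : Module.finrank K D' < n := by
    rw [← hn]
    refine Submodule.finrank_lt_finrank_of_lt (lt_of_le_of_ne hD'D fun h => hφx ?_)
    rw [← h] at hx
    exact hx.2
  have : FiniteDimensional K D' := Submodule.finiteDimensional_of_le hD'D
  have h3 : f - q ∈ D' * E.prod := by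
    convert Submodule.add_mem _ hfg hq' using 1
    ring
  have h4 := hrec _ hlt D' (hD'D.trans hD) h3 (Ideal.sub_mem _ hfV (relSpan_le _ _ hq)) rfl
  simpa using Submodule.add_mem _ h4 hq

/-- Over an infinite field, the kernel of the multiplication map from products of spaces of linear
forms to the symmetric algebra modulo `V` is spanned by determinants of relations. -/
theorem mem_relSpan [Infinite K] [Finite σ] (E : Multiset (Submodule K (MvPolynomial σ K)))
    (hE : ∀ F ∈ E, F ≤ homogeneousSubmodule σ K 1)
    (V : Submodule K (MvPolynomial σ K)) (hV : V ≤ homogeneousSubmodule σ K 1)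
    (f : MvPolynomial σ K) (hf : f ∈ E.prod)
    (hfV : f ∈ Ideal.span (V : Set (MvPolynomial σ K))) : f ∈ relSpan E V := by
  induction E using Multiset.induction_on generalizing V f with
  | empty =>
    rw [Multiset.prod_zero, Submodule.mem_one] at hf
    obtain ⟨c, rfl⟩ := hf
    obtain ⟨π, h1, -⟩ := exists_algHom_ker_span V hV
    rw [h1, AlgHom.commutes] at hfV
    rw [hfV]
    exact Submodule.zero_mem _
  | cons E₁ E ih =>
    rw [Multiset.prod_cons] at hf
    have : FiniteDimensional K (homogeneousSubmodule σ K 1) := by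
      rw [homogeneousSubmodule_one_eq_span_X]
      exact FiniteDimensional.span_of_finite K (Set.finite_range _)
    have : FiniteDimensional K E₁ :=
      Submodule.finiteDimensional_of_le (hE E₁ (Multiset.mem_cons_self _ _))
    exact mem_relSpan_of_mem_mul E E₁ V hV (hE _ (Multiset.mem_cons_self _ _))
      (fun V' hV' g hg hg' => ih (fun F hF => hE F (Multiset.mem_cons_of_mem hF)) V' hV' g hg hg')
      E₁ le_rfl hf hfV

end

/-! ### Multigraded linear forms and the determinantal ideal -/

section

section LinForms

variable {σ ι K : Type*} [Field K]

/-- The forms whose degree is the `i`-th basis vector, if `X j` has degree the `d j`-th one. -/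
abbrev formsOf (K : Type*) [Field K] (d : σ → ι) (i : ι) : Submodule K (MvPolynomial σ K) :=
  weightedHomogeneousSubmodule K (fun j => Finsupp.single (d j) 1) (Finsupp.single i 1)

lemma weight_single (d : σ → ι) (a : σ →₀ ℕ) :
    Finsupp.weight (fun j => Finsupp.single (d j) 1) a = a.mapDomain d := by
  rw [Finsupp.weight_apply, Finsupp.mapDomain]
  refine Finsupp.sum_congr fun j _ => ?_
  rw [Finsupp.smul_single, smul_eq_mul, mul_one]

lemma formsOf_le (d : σ → ι) (i : ι) : formsOf K d i ≤ homogeneousSubmodule σ K 1 := by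
  intro f hf a ha
  have h1 := hf ha
  rw [weight_single] at h1
  have h2 := congrArg Finsupp.degree h1
  rw [Finsupp.degree_single] at h2
  rw [← h2]
  rw [Pi.one_def, ← Finsupp.degree_eq_weight_one, Finsupp.degree_mapDomain]

/-- A monomial of degree `b` is a product of variables, `b i` of them of degree `e_i`. This makes
`mem_relSpan` applicable to multihomogeneous polynomials. -/
lemma mem_prod_formsOf (d : σ → ι) (b : ι →₀ ℕ) {f : MvPolynomial σ K}
    (hf : IsWeightedHomogeneous (fun j => Finsupp.single (d j) 1) f b) :
    f ∈ (b.toMultiset.map (formsOf K d)).prod := by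
  rw [f.as_sum]
  refine Submodule.sum_mem _ fun a ha => ?_
  have h1 := hf (mem_support_iff.1 ha)
  rw [weight_single] at h1
  rw [← h1, ← Finsupp.toMultiset_map, Multiset.map_map, ← mul_one (coeff a f), ← smul_eq_mul,
    ← smul_monomial]
  refine Submodule.smul_mem _ _ ?_
  clear h1 ha
  induction a using Finsupp.induction_linear with
  | zero => exact ⟨1, by simp⟩
  | add a b ha hb =>
    rw [map_add, Multiset.map_add, Multiset.prod_add, ← one_mul (1 : K), ← monomial_mul]
    exact Submodule.mul_mem_mul ha hb
  | single j n =>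
    rw [Finsupp.toMultiset_single, Multiset.map_nsmul, Multiset.prod_nsmul, Multiset.map_singleton,
      Multiset.prod_singleton, ← X_pow_eq_monomial]
    exact Submodule.pow_mem_pow _ (isWeightedHomogeneous_X K _ j) n

end LinForms

variable {σ K : Type*} [Field K] {u : ℕ}

/-- The ideal generated by the determinants of square matrices whose rows consist of linear forms
of the distinct degrees `e_a`, `a ∈ A`, and whose column sums lie in `V`. -/
def detIdeal (d : σ → Fin u) (V : Submodule K (MvPolynomial σ K)) : Ideal (MvPolynomial σ K) :=
  Ideal.span {z | ∃ (A : Finset (Fin u)) (_ : A.Nonempty)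
    (M : Matrix (Fin A.card) (Fin A.card) (MvPolynomial σ K)),
    (∀ p j, M p j ∈ formsOf K d (A.orderEmbOfFin rfl p)) ∧ (∀ j, ∑ p, M p j ∈ V) ∧ z = M.det}

/-- If rows `p` and `q` have the same degree, row `q` is added to row `p` and the determinant is
expanded along row `q`. The minors have the original column sums, since row `q` survives inside row
`p`, so induction on the size applies. Distinct degrees only need sorting. -/
lemma det_mem_detIdeal (d : σ → Fin u) (V : Submodule K (MvPolynomial σ K)) {k : ℕ}
    (r : Fin (k + 1) → Fin u) (M : Matrix (Fin (k + 1)) (Fin (k + 1)) (MvPolynomial σ K))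
    (hM : ∀ p j, M p j ∈ formsOf K d (r p)) (hV : ∀ j, ∑ p, M p j ∈ V) :
    M.det ∈ detIdeal d V := by
  induction k with
  | zero =>
    refine Ideal.subset_span ⟨{r 0}, Finset.singleton_nonempty _, M, fun p j => ?_, hV, rfl⟩
    have h : (Finset.orderEmbOfFin {r 0} rfl p) = r p := by
      rw [show p = (0 : Fin 1) from Subsingleton.elim (α := Fin 1) _ _]
      exact Finset.orderEmbOfFin_singleton (r 0) _
    rw [h]
    exact hM p j
  | succ k ih =>
    by_cases hr : Function.Injective r
    · set A : Finset (Fin u) := Finset.univ.map ⟨r, hr⟩ with hA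
      have hcard : A.card = k + 1 + 1 := by simp [hA]
      have hne : A.Nonempty := by rw [← Finset.card_pos, hcard]; omega
      have hmem : ∀ p : Fin A.card, ∃ q, r q = A.orderEmbOfFin rfl p := fun p => by
        have := Finset.orderEmbOfFin_mem A rfl p
        obtain ⟨q, -, hq⟩ := Finset.mem_map.1 this
        exact ⟨q, hq⟩
      choose e he using hmem
      have hinj : Function.Injective e := fun p q h => by
        have := he p
        rw [h, he q] at this
        exact ((A.orderEmbOfFin rfl).injective this).symm
      have hbij : Function.Bijective e :=
        (Fintype.bijective_iff_injective_and_card e).2 ⟨hinj, by simp [hcard]⟩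
      let E := Equiv.ofBijective e hbij
      rw [← Matrix.det_submatrix_equiv_self E M]
      refine Ideal.subset_span ⟨A, hne, _, fun p j => ?_, fun j => ?_, rfl⟩
      · rw [← he p]
        exact hM _ _
      · have := Equiv.sum_comp E (fun p => M p (E j))
        simp only [Matrix.submatrix_apply]
        rw [this]
        exact hV _
    · obtain ⟨p, q, hpq, hne⟩ : ∃ p q, r p = r q ∧ p ≠ q := by
        simpa [Function.Injective] using hr
      rw [← Matrix.det_updateRow_add_self M hne, Matrix.det_succ_row _ q]
      refine Ideal.sum_mem _ fun j _ => Ideal.mul_mem_left _ _ ?_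
      refine ih (fun i => r (q.succAbove i)) _ (fun i l => ?_) (fun l => ?_)
      · rw [Matrix.submatrix_apply, Matrix.updateRow_apply]
        split_ifs with h
        · rw [h]
          exact Submodule.add_mem _ (hM _ _) (hpq ▸ hM q _)
        · exact hM _ _
      · have h1 := Fin.sum_univ_succAbove
          (fun i => (M.updateRow p (M p + M q)) i (j.succAbove l)) q
        have h2 : ∑ i, (M.updateRow p (M p + M q)) i (j.succAbove l) =
            ∑ i, M i (j.succAbove l) + M q (j.succAbove l) := by
          rw [← Finset.add_sum_erase _ _ (Finset.mem_univ p),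
            ← Finset.add_sum_erase _ (fun i => M i (j.succAbove l)) (Finset.mem_univ p),
            Matrix.updateRow_self, Finset.sum_congr rfl fun i hi => by
              rw [Matrix.updateRow_ne (Finset.ne_of_mem_erase hi)]]
          simp only [Pi.add_apply]
          ring
        rw [h2, Matrix.updateRow_ne hne.symm, add_comm] at h1
        simp only [Matrix.submatrix_apply]
        rw [← add_left_cancel h1]
        exact hV _

lemma mem_detIdeal_of_infinite [Infinite K] [Finite σ] (d : σ → Fin u)
    (V : Submodule K (MvPolynomial σ K)) (hV : V ≤ homogeneousSubmodule σ K 1)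
    {f : MvPolynomial σ K} {b : Fin u →₀ ℕ}
    (hf : IsWeightedHomogeneous (fun j => Finsupp.single (d j) 1) f b)
    (hfV : f ∈ Ideal.span (V : Set (MvPolynomial σ K))) : f ∈ detIdeal d V := by
  have h := mem_relSpan (b.toMultiset.map (formsOf K d))
    (fun F hF => by
      obtain ⟨i, -, rfl⟩ := Multiset.mem_map.1 hF
      exact formsOf_le d i) V hV f (mem_prod_formsOf d b hf) hfV
  clear hf hfV
  induction h using Submodule.span_induction with
  | mem z hz =>
    obtain ⟨k, F, G, M, h, hE, hM, hMV, -, rfl⟩ := hz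
    refine Ideal.mul_mem_right _ _ ?_
    have hF : ∀ p, ∃ i, formsOf K d i = F p := fun p => by
      have : F p ∈ b.toMultiset.map (formsOf K d) := by
        rw [hE, Multiset.mem_add]
        exact Or.inl (Multiset.mem_coe.2 (List.mem_ofFn.2 ⟨p, rfl⟩))
      obtain ⟨i, -, h⟩ := Multiset.mem_map.1 this
      exact ⟨i, h⟩
    choose r hr using hF
    exact det_mem_detIdeal d V r M (fun p j => by rw [hr]; exact hM p j) hMV
  | zero => exact Ideal.zero_mem _
  | add x y _ _ hx hy => exact Ideal.add_mem _ hx hy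
  | smul c x _ hx => rw [smul_eq_C_mul]; exact Ideal.mul_mem_left _ _ hx

/-! ### Descent from an extension field -/

section BaseChange

variable {L : Type*} [Field L] [Algebra K L]

/-- Application of a `K`-linear functional `L → K` to the coefficients of a polynomial. -/
def mapCoeff (ρ : L →ₗ[K] K) : MvPolynomial σ L →+ MvPolynomial σ K where
  toFun := AddMonoidAlgebra.map ρ.toAddMonoidHom
  map_zero' := by ext; simp
  map_add' x y := by ext; simp

lemma coeff_mapCoeff (ρ : L →ₗ[K] K) (f : MvPolynomial σ L) (a : σ →₀ ℕ) :
    coeff a (mapCoeff ρ f) = ρ (coeff a f) := rfl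

lemma mapCoeff_mul_map (ρ : L →ₗ[K] K) (f : MvPolynomial σ L) (g : MvPolynomial σ K) :
    mapCoeff ρ (f * map (algebraMap K L) g) = mapCoeff ρ f * g := by
  classical
  ext a
  rw [coeff_mapCoeff, coeff_mul, coeff_mul, map_sum]
  refine Finset.sum_congr rfl fun p _ => ?_
  rw [coeff_map, mul_comm, ← Algebra.smul_def, map_smul, coeff_mapCoeff, smul_eq_mul, mul_comm]

/-- A `K`-linear retraction `L → K`, applied to coefficients, is linear over the polynomials with
coefficients in `K`; it fixes these and maps the extended ideal back into `I`. -/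
lemma mem_of_map_mem_map (I : Ideal (MvPolynomial σ K)) {f : MvPolynomial σ K}
    (h : map (algebraMap K L) f ∈ I.map (map (algebraMap K L))) : f ∈ I := by
  obtain ⟨ρ, hρ⟩ := LinearMap.exists_leftInverse_of_injective (Algebra.linearMap K L)
    (LinearMap.ker_eq_bot.2 (algebraMap K L).injective)
  have key : ∀ g ∈ I.map (map (algebraMap K L)), ∀ c, mapCoeff ρ (c * g) ∈ I := by
    intro g hg
    induction hg using Submodule.span_induction with
    | mem z hz =>
      obtain ⟨z, hz, rfl⟩ := hz
      intro c
      rw [mapCoeff_mul_map]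
      exact I.mul_mem_left _ hz
    | zero => simp
    | add x y _ _ hx hy => intro c; rw [mul_add, map_add]; exact I.add_mem (hx c) (hy c)
    | smul e x _ ih => intro c; rw [smul_eq_mul, ← mul_assoc]; exact ih _
  have := key _ h 1
  rwa [mapCoeff_mul_map, show mapCoeff ρ (1 : MvPolynomial σ L) = 1 from ?_,
    one_mul] at this
  classical
  ext a
  rw [coeff_mapCoeff, coeff_one, coeff_one]
  have h1 : ρ 1 = 1 := by simpa using DFunLike.congr_fun hρ 1
  split_ifs
  · exact h1
  · exact map_zero ρ

lemma mapCoeff_mem_formsOf (ρ : L →ₗ[K] K) (d : σ → Fin u) (i : Fin u) {f : MvPolynomial σ L}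
    (hf : f ∈ formsOf L d i) : mapCoeff ρ f ∈ formsOf K d i := by
  intro a ha
  refine hf fun h => ha ?_
  rw [coeff_mapCoeff, h, map_zero]

lemma mapCoeff_mem_of_mem_span (V : Submodule K (MvPolynomial σ K)) {f : MvPolynomial σ L}
    (hf : f ∈ Submodule.span L (map (algebraMap K L) '' (V : Set (MvPolynomial σ K))))
    (ρ : L →ₗ[K] K) : mapCoeff ρ f ∈ V := by
  -- The functional must vary: a scalar `c` of `L` is absorbed by replacing `ρ` with `ρ (c * ·)`.
  induction hf using Submodule.span_induction generalizing ρ with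
  | mem x hx =>
    obtain ⟨x, hx, rfl⟩ := hx
    have : mapCoeff ρ (map (algebraMap K L) x) = ρ 1 • x := by
      ext a
      rw [coeff_mapCoeff, coeff_map, coeff_smul, Algebra.algebraMap_eq_smul_one, map_smul,
        smul_eq_mul, smul_eq_mul, mul_comm]
    rw [this]
    exact V.smul_mem _ hx
  | zero => simp
  | add x y _ _ hx hy => rw [map_add]; exact V.add_mem (hx ρ) (hy ρ)
  | smul c x _ ih =>
    have : mapCoeff ρ (c • x) = mapCoeff (ρ ∘ₗ LinearMap.mulLeft K c) x := by
      ext a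
      simp [coeff_mapCoeff]
    rw [this]
    exact ih _

lemma eq_sum_map_mapCoeff {κ : Type*} (b : Module.Basis κ K L) (f : MvPolynomial σ L)
    (s : Finset κ) (hs : ∀ a ∈ f.support, (b.repr (coeff a f)).support ⊆ s) :
    f = ∑ i ∈ s, C (b i) * map (algebraMap K L) (mapCoeff (b.coord i) f) := by
  ext a
  rw [coeff_sum]
  simp only [coeff_C_mul, coeff_map, coeff_mapCoeff, Module.Basis.coord_apply]
  by_cases ha : a ∈ f.support
  · conv_lhs => rw [← b.linearCombination_repr (coeff a f), Finsupp.linearCombination_apply]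
    rw [Finsupp.sum_of_support_subset _ (hs a ha) _ (by simp)]
    refine Finset.sum_congr rfl fun i _ => ?_
    rw [Algebra.smul_def, mul_comm]
  · rw [notMem_support_iff.1 ha]
    simp

/-- The coefficients are expanded in a basis of `L` over `K`. Each coordinate of the column is again
a column of forms of the same degrees, now over `K`, and its sum lies in `V`. -/
lemma mem_span_map_columns (d : σ → Fin u) (V : Submodule K (MvPolynomial σ K)) {k : ℕ}
    (r : Fin k → Fin u) (c : Fin k → MvPolynomial σ L) (hc : ∀ p, c p ∈ formsOf L d (r p))
    (hcV : ∑ p, c p ∈ Submodule.span L (map (algebraMap K L) '' (V : Set (MvPolynomial σ K)))) :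
    c ∈ Submodule.span (MvPolynomial σ L) {x | ∃ y : Fin k → MvPolynomial σ K,
      (∀ p, y p ∈ formsOf K d (r p)) ∧ ∑ p, y p ∈ V ∧ x = fun p => map (algebraMap K L) (y p)} := by
  classical
  let b := Module.Basis.ofVectorSpace K L
  set s := Finset.univ.biUnion fun p => (c p).support.biUnion fun a =>
    (b.repr (coeff a (c p))).support with hs
  have : c = ∑ i ∈ s, (C (b i) : MvPolynomial σ L) •
      fun p => map (algebraMap K L) (mapCoeff (b.coord i) (c p)) := by
    ext1 p
    rw [Finset.sum_apply]
    refine eq_sum_map_mapCoeff b (c p) s fun a ha => ?_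
    refine Finset.Subset.trans ?_ (Finset.subset_biUnion_of_mem _ (Finset.mem_univ p))
    exact Finset.subset_biUnion_of_mem (fun a => (b.repr (coeff a (c p))).support) ha
  rw [this]
  refine Submodule.sum_mem _ fun i _ => Submodule.smul_mem _ _ (Submodule.subset_span
    ⟨_, fun p => mapCoeff_mem_formsOf _ d _ (hc p), ?_, rfl⟩)
  rw [← map_sum]
  exact mapCoeff_mem_of_mem_span V hcV _

lemma detIdeal_span_map_le (d : σ → Fin u) (V : Submodule K (MvPolynomial σ K)) :
    detIdeal d (Submodule.span L (map (algebraMap K L) '' (V : Set (MvPolynomial σ K)))) ≤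
      (detIdeal d V).map (map (algebraMap K L)) := by
  refine Ideal.span_le.2 ?_
  rintro z ⟨A, hA, M, hM, hMV, rfl⟩
  rw [SetLike.mem_coe, ← Matrix.det_transpose]
  refine det_mem_of_rows_mem_span _ _ (fun N hN => ?_) _ fun j =>
    mem_span_map_columns d V (A.orderEmbOfFin rfl) _ (fun p => hM p j) (hMV j)
  choose y h1 h2 h3 using hN
  have : N.det = map (algebraMap K L) (Matrix.of fun p j => y j p).det := by
    rw [RingHom.map_det, ← Matrix.det_transpose]
    congr 1
    ext1 p j
    exact congrFun (h3 j) p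
  rw [this]
  exact Ideal.mem_map_of_mem _ (Ideal.subset_span ⟨A, hA, _, fun p j => h1 j p, h2, rfl⟩)

end BaseChange

/-- A multihomogeneous element of an ideal generated by a space `V` of linear forms is a
combination of determinants of relations modulo `V` between linear forms of distinct degrees. -/
theorem mem_detIdeal [Finite σ] (d : σ → Fin u)
    (V : Submodule K (MvPolynomial σ K)) (hV : V ≤ homogeneousSubmodule σ K 1)
    {f : MvPolynomial σ K} {b : Fin u →₀ ℕ}
    (hf : IsWeightedHomogeneous (fun j => Finsupp.single (d j) 1) f b)
    (hfV : f ∈ Ideal.span (V : Set (MvPolynomial σ K))) : f ∈ detIdeal d V := by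
  let L := AlgebraicClosure K
  have : Infinite L := IsAlgClosed.instInfinite
  refine mem_of_map_mem_map (L := L) _ (detIdeal_span_map_le d V
    (mem_detIdeal_of_infinite d _ (b := b) (Submodule.span_le.2 ?_) ?_ ?_))
  · rintro _ ⟨l, hl, rfl⟩
    exact IsHomogeneous.map (hV hl) _
  · intro a ha
    refine hf fun h => ha ?_
    rw [coeff_map, h, map_zero]
  · have h1 := Ideal.mem_map_of_mem (map (algebraMap K L)) hfV
    rw [Ideal.map_span] at h1
    exact Ideal.span_mono Submodule.subset_span h1

end

/-! ### Minors and the largest multigraded subideal -/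

section

lemma minorIdeal_le_sum {R : Type*} [CommRing R] {u : ℕ} {κ : Finset (Fin u) → Type*}
    (X : (A : Finset (Fin u)) → Matrix (Fin A.card) (κ A) R) {A : Finset (Fin u)}
    (hA : A.Nonempty) :
    minorIdeal A.card (X A) ≤ ∑ A : Finset (Fin u) with A.Nonempty, minorIdeal A.card (X A) :=
  Finset.single_le_sum (f := fun A : Finset (Fin u) => minorIdeal A.card (X A))
    (fun _ _ => zero_le) (Finset.mem_filter.2 ⟨Finset.mem_univ _, hA⟩)

/-- By multilinearity the columns may be taken among those of `X`; a repeated column gives zero, and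
distinct ones give a minor. -/
lemma det_mem_minorIdeal {R κ : Type*} [CommRing R] {k : ℕ} (X : Matrix (Fin k) κ R)
    (M : Matrix (Fin k) (Fin k) R)
    (hM : ∀ j, (fun p => M p j) ∈ Submodule.span R (Set.range X.transpose)) :
    M.det ∈ minorIdeal k X := by
  rw [← Matrix.det_transpose]
  refine det_mem_of_rows_mem_span _ _ (fun N hN => ?_) _ hM
  choose c hc using hN
  rw [← Matrix.det_transpose]
  by_cases hinj : Function.Injective c
  · refine Ideal.subset_span ⟨Function.Embedding.refl _, ⟨c, hinj⟩, ?_⟩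
    congr 1
    ext1 p j
    exact (congrFun (hc j) p).symm
  · obtain ⟨i, j, hij, hne⟩ : ∃ i j, c i = c j ∧ i ≠ j := by
      simpa [Function.Injective] using hinj
    rw [Matrix.det_zero_of_column_eq hne fun p => ?_]
    · exact Ideal.zero_mem _
    · rw [Matrix.transpose_apply, Matrix.transpose_apply, ← hc i, ← hc j, hij]

section

variable {σ K : Type*} [Field K] {u : ℕ}

/-- Reduces the inclusion in the ideal of minors to linear algebra on a single column. -/
lemma detIdeal_le_sum_minorIdeal (d : σ → Fin u) (V : Submodule K (MvPolynomial σ K))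
    {κ : Finset (Fin u) → Type*}
    (X : (A : Finset (Fin u)) → Matrix (Fin A.card) (κ A) (MvPolynomial σ K))
    (hX : ∀ A : Finset (Fin u), A.Nonempty → ∀ c : Fin A.card → MvPolynomial σ K,
      (∀ p, c p ∈ formsOf K d (A.orderEmbOfFin rfl p)) → ∑ p, c p ∈ V →
        c ∈ Submodule.span (MvPolynomial σ K) (Set.range (X A).transpose)) :
    detIdeal d V ≤ ∑ A : Finset (Fin u) with A.Nonempty, minorIdeal A.card (X A) := by
  refine Ideal.span_le.2 ?_
  rintro z ⟨A, hA, M, hM, hMV, rfl⟩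
  exact minorIdeal_le_sum X hA
    (det_mem_minorIdeal (X A) M fun j => hX A hA _ (fun p => hM p j) (hMV j))

/-- The component of degree `e_i` of a polynomial. -/
abbrev comp (d : σ → Fin u) (i : Fin u) : MvPolynomial σ K →ₗ[K] MvPolynomial σ K :=
  weightedHomogeneousComponent (fun j => Finsupp.single (d j) 1) (Finsupp.single i 1)

lemma comp_of_mem (d : σ → Fin u) {i : Fin u} {f : MvPolynomial σ K} (hf : f ∈ formsOf K d i)
    (j : Fin u) : comp d j f = if i = j then f else 0 := by
  rw [comp, weightedHomogeneousComponent_of_mem hf]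
  simp [Finsupp.single_left_inj, eq_comm]

lemma sum_orderEmbOfFin {M : Type*} [AddCommMonoid M] (A : Finset (Fin u)) (g : Fin u → M) :
    ∑ p, g (A.orderEmbOfFin rfl p) = ∑ i ∈ A, g i := by
  conv_rhs => rw [← Finset.map_orderEmbOfFin_univ A rfl, Finset.sum_map]
  rfl

lemma sum_comp_of_mem_iSup (d : σ → Fin u) (A : Finset (Fin u)) {f : MvPolynomial σ K}
    (hf : f ∈ ⨆ i ∈ A, formsOf K d i) : ∑ i ∈ A, comp d i f = f := by
  have h : ⨆ i ∈ A, formsOf K d i ≤ LinearMap.eqLocus (∑ i ∈ A, comp d i) LinearMap.id := by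
    refine iSup₂_le fun i hi g hg => ?_
    rw [LinearMap.mem_eqLocus, LinearMap.sum_apply, LinearMap.id_apply,
      Finset.sum_congr rfl fun j _ => comp_of_mem d hg j, Finset.sum_ite_eq, if_pos hi]
  simpa using h hf

lemma sum_comp_of_mem (d : σ → Fin u) {f : MvPolynomial σ K}
    (hf : f ∈ homogeneousSubmodule σ K 1) : ∑ i, comp d i f = f := by
  refine sum_comp_of_mem_iSup d Finset.univ ?_
  rw [homogeneousSubmodule_one_eq_span_X] at hf
  refine Submodule.span_le.2 ?_ hf
  rintro _ ⟨j, rfl⟩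
  exact Submodule.mem_iSup_of_mem (d j) (Submodule.mem_iSup_of_mem (Finset.mem_univ _)
    (isWeightedHomogeneous_X K _ j))

lemma comp_sum_columns (d : σ → Fin u) (A : Finset (Fin u)) (c : Fin A.card → MvPolynomial σ K)
    (hc : ∀ p, c p ∈ formsOf K d (A.orderEmbOfFin rfl p)) (q : Fin A.card) :
    comp d (A.orderEmbOfFin rfl q) (∑ p, c p) = c q := by
  rw [map_sum, Finset.sum_congr rfl fun p _ => comp_of_mem d (hc p) _]
  simp

lemma comp_sum_columns_of_notMem (d : σ → Fin u) (A : Finset (Fin u))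
    (c : Fin A.card → MvPolynomial σ K)
    (hc : ∀ p, c p ∈ formsOf K d (A.orderEmbOfFin rfl p)) {i : Fin u} (hi : i ∉ A) :
    comp d i (∑ p, c p) = 0 := by
  rw [map_sum, Finset.sum_congr rfl fun p _ => comp_of_mem d (hc p) _]
  refine Finset.sum_eq_zero fun p _ => if_neg fun h => hi ?_
  rw [← h]
  exact Finset.orderEmbOfFin_mem A rfl p

lemma det_isWeightedHomogeneous (d : σ → Fin u) {k : ℕ} (r : Fin k → Fin u)
    (M : Matrix (Fin k) (Fin k) (MvPolynomial σ K)) (hM : ∀ p j, M p j ∈ formsOf K d (r p)) :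
    IsWeightedHomogeneous (fun j => Finsupp.single (d j) 1) M.det
      (∑ p, Finsupp.single (r p) 1) := by
  rw [← Matrix.det_transpose, Matrix.det_apply]
  refine (weightedHomogeneousSubmodule K (fun j => Finsupp.single (d j) 1)
    (∑ p, Finsupp.single (r p) 1)).sum_mem fun s _ => ?_
  rw [Units.smul_def]
  exact zsmul_mem (IsWeightedHomogeneous.prod Finset.univ _ _ fun p _ => hM p (s p)) _

end

variable {K : Type*} [Field K] {n u : ℕ} (d : Fin n → Fin u)
  (V : Submodule K (MvPolynomial (Fin n) K))

lemma comp_mem_span_columns {v : ℕ} (A : Finset (Fin u)) (L : Fin v → MvPolynomial (Fin n) K)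
    {l : MvPolynomial (Fin n) K} (hl : l ∈ Submodule.span K (Set.range L)) :
    (fun p => comp d (A.orderEmbOfFin rfl p) l) ∈
      Submodule.span K (Set.range (matM d A L).transpose) := by
  let Φ : MvPolynomial (Fin n) K →ₗ[K] Fin A.card → MvPolynomial (Fin n) K :=
    LinearMap.pi fun p => comp d (A.orderEmbOfFin rfl p)
  have h := Submodule.mem_map_of_mem (f := Φ) hl
  rw [Submodule.map_span, ← Set.range_comp] at h
  exact h

lemma mem_subspaceOn_of_columns (A : Finset (Fin u)) (c : Fin A.card → MvPolynomial (Fin n) K)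
    (hc : ∀ p, c p ∈ formsOf K d (A.orderEmbOfFin rfl p)) (hV : ∑ p, c p ∈ V) :
    ∑ p, c p ∈ subspaceOn d V A :=
  ⟨hV, Submodule.sum_mem _ fun p _ => Submodule.mem_iSup_of_mem _
    (Submodule.mem_iSup_of_mem (Finset.orderEmbOfFin_mem A rfl p) (hc p))⟩

lemma sum_matM_mem {v : ℕ} (A : Finset (Fin u)) (L : Fin v → MvPolynomial (Fin n) K)
    (hL : ∀ i, L i ∈ subspaceOn d V A) (r : Fin A.card ↪ Fin A.card) (i : Fin v) :
    ∑ p, matM d A L (r p) i ∈ V := by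
  have hr : Function.Bijective r := Finite.injective_iff_bijective.1 r.injective
  rw [hr.sum_comp (fun p => matM d A L p i)]
  have := sum_comp_of_mem_iSup d A (hL i).2
  rw [← sum_orderEmbOfFin] at this
  exact this ▸ (hL i).1

lemma starIdeal_eq (hV : V ≤ homogeneousSubmodule (Fin n) K 1) (v : Finset (Fin u) → ℕ)
    (L : (A : Finset (Fin u)) → Fin (v A) → MvPolynomial (Fin n) K)
    (hL : ∀ A : Finset (Fin u), A.Nonempty →
      Submodule.span K (Set.range (L A)) = subspaceOn d V A) :
    starIdeal d (linIdeal V) =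
      ∑ A : Finset (Fin u) with A.Nonempty, minorIdeal A.card (matM d A (L A)) := by
  apply le_antisymm
  · refine Ideal.span_le.2 ?_
    rintro _ ⟨⟨f, b, hf⟩, hfV, rfl⟩
    refine detIdeal_le_sum_minorIdeal d V (fun A => matM d A (L A)) (fun A hA c hc hcV => ?_)
      (mem_detIdeal d V hV (b := b) hf hfV)
    have h1 := comp_mem_span_columns d A (L A)
      ((hL A hA).symm ▸ mem_subspaceOn_of_columns d V A c hc hcV)
    simp only [comp_sum_columns d A c hc] at h1
    exact Submodule.span_le_restrictScalars K (MvPolynomial (Fin n) K) _ h1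
  · rw [Ideal.sum_eq_sup]
    refine Finset.sup_le fun A hA => Ideal.span_le.2 ?_
    have hA : A.Nonempty := (Finset.mem_filter.1 hA).2
    rintro _ ⟨r, c, rfl⟩
    have : NeZero A.card := ⟨hA.card_pos.ne'⟩
    refine Ideal.subset_span ⟨⟨_, ⟨_, det_isWeightedHomogeneous d
      (fun p => A.orderEmbOfFin rfl (r p)) _ fun p j => ?_⟩⟩, ?_, rfl⟩
    · exact weightedHomogeneousComponent_mem _ _ _
    · refine det_mem_of_sum_mem _ _ fun j => Ideal.subset_span (sum_matM_mem d V A (L A)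
        (fun i => ?_) r (c j))
      rw [← hL A hA]
      exact Submodule.subset_span ⟨i, rfl⟩

end

/-! ### Homogenization -/

section

variable {K : Type*} [Field K] {n u : ℕ} (d : Fin n → Fin u)

/-- Multidegrees in `S`: the variable `y_i` has degree `e_i`. -/
abbrev extDeg : Fin n ⊕ Fin u → Fin u := Sum.elim d id

/-- Substitution of `1` for all the variables `y_i`. -/
def dehomogenize (K : Type*) [Field K] (n u : ℕ) :
    MvPolynomial (Fin n ⊕ Fin u) K →ₐ[K] MvPolynomial (Fin n) K :=
  aeval (Sum.elim X 1)

lemma sumElim_eq_add (a : Fin n →₀ ℕ) (e : Fin u →₀ ℕ) :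
    a.sumElim e = a.mapDomain Sum.inl + e.mapDomain Sum.inr := by
  ext (i | i)
  · rw [Finsupp.sumElim_inl, Finsupp.add_apply, Finsupp.mapDomain_apply Sum.inl_injective,
      Finsupp.mapDomain_of_notMem_range _ _ (by simp), add_zero]
  · rw [Finsupp.sumElim_inr, Finsupp.add_apply, Finsupp.mapDomain_apply Sum.inr_injective,
      Finsupp.mapDomain_of_notMem_range _ _ (by simp), zero_add]

lemma monomial_sumElim (a : Fin n →₀ ℕ) (e : Fin u →₀ ℕ) (c : K) :
    monomial (a.sumElim e) c = rename Sum.inl (monomial a c) * rename Sum.inr (monomial e 1) := by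
  rw [rename_monomial, rename_monomial, monomial_mul, mul_one, sumElim_eq_add]

lemma exists_eq_sumElim (m : Fin n ⊕ Fin u →₀ ℕ) :
    ∃ (a : Fin n →₀ ℕ) (e : Fin u →₀ ℕ), m = a.sumElim e :=
  ⟨m.comapDomain Sum.inl Sum.inl_injective.injOn, m.comapDomain Sum.inr Sum.inr_injective.injOn, by
    ext (i | i) <;> rfl⟩

lemma mapDomain_sumElim (a : Fin n →₀ ℕ) (e : Fin u →₀ ℕ) :
    (a.sumElim e).mapDomain (extDeg d) = a.mapDomain d + e := by
  rw [sumElim_eq_add, Finsupp.mapDomain_add, ← Finsupp.mapDomain_comp, ← Finsupp.mapDomain_comp]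
  simp [extDeg]

lemma dehomogenize_monomial (a : Fin n →₀ ℕ) (e : Fin u →₀ ℕ) (c : K) :
    dehomogenize K n u (monomial (a.sumElim e) c) = monomial a c := by
  rw [monomial_sumElim, map_mul, dehomogenize, aeval_rename, aeval_rename, Sum.elim_comp_inl,
    Sum.elim_comp_inr, aeval_X_left_apply, aeval_monomial]
  simp

/-- The homogenization of a polynomial to a given degree `b`, linear in the polynomial. -/
def homogenizeTo (b : Fin u →₀ ℕ) :
    MvPolynomial (Fin n) K →ₗ[K] MvPolynomial (Fin n ⊕ Fin u) K :=
  (basisMonomials (Fin n) K).constr K fun a =>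
    monomial (a.sumElim (b - a.mapDomain d)) 1

lemma homogenizeTo_monomial (b : Fin u →₀ ℕ) (a : Fin n →₀ ℕ) (c : K) :
    homogenizeTo d b (monomial a c) = monomial (a.sumElim (b - a.mapDomain d)) c := by
  rw [← mul_one c, ← smul_eq_mul, ← smul_monomial, ← smul_monomial, map_smul]
  congr 1
  exact (basisMonomials (Fin n) K).constr_basis K _ a

lemma homogenizeTo_apply (b : Fin u →₀ ℕ) (f : MvPolynomial (Fin n) K) :
    homogenizeTo d b f =
      ∑ a ∈ f.support, monomial (a.sumElim (b - a.mapDomain d)) (coeff a f) := by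
  conv_lhs => rw [f.as_sum, map_sum]
  exact Finset.sum_congr rfl fun a _ => homogenizeTo_monomial d b a _

lemma homogenize_eq (f : MvPolynomial (Fin n) K) :
    homogenize d f =
      ∑ a ∈ f.support, monomial (a.sumElim (lcmDeg d f - a.mapDomain d)) (coeff a f) := by
  refine Finset.sum_congr rfl fun a _ => ?_
  rw [monomial_sumElim, ← weight_single]
  rfl

lemma mapDomain_le_lcmDeg (f : MvPolynomial (Fin n) K) {a : Fin n →₀ ℕ} (ha : a ∈ f.support) :
    a.mapDomain d ≤ lcmDeg d f := by
  rw [← weight_single]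
  exact Finset.le_sup (f := fun a => Finsupp.weight (varDeg d) a) ha

lemma homogenize_isWeightedHomogeneous (f : MvPolynomial (Fin n) K) :
    IsWeightedHomogeneous (fun j => Finsupp.single (extDeg d j) 1) (homogenize d f)
      (lcmDeg d f) := by
  rw [homogenize_eq]
  refine IsWeightedHomogeneous.sum _ _ _ fun a ha => isWeightedHomogeneous_monomial _ _ _ ?_
  rw [weight_single, mapDomain_sumElim, add_tsub_cancel_of_le (mapDomain_le_lcmDeg d f ha)]

/-- In a monomial of degree `b` the exponent of the `y_i` is determined by that of the `x_j`. -/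
lemma homogenizeTo_dehomogenize {F : MvPolynomial (Fin n ⊕ Fin u) K} {b : Fin u →₀ ℕ}
    (hF : IsWeightedHomogeneous (fun j => Finsupp.single (extDeg d j) 1) F b) :
    homogenizeTo d b (dehomogenize K n u F) = F := by
  conv_lhs => rw [F.as_sum, map_sum, map_sum]
  conv_rhs => rw [F.as_sum]
  refine Finset.sum_congr rfl fun m hm => ?_
  have h := hF (mem_support_iff.1 hm)
  obtain ⟨a, e, rfl⟩ := exists_eq_sumElim m
  rw [weight_single, mapDomain_sumElim] at h
  rw [dehomogenize_monomial, homogenizeTo_monomial, ← h, add_tsub_cancel_left]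

lemma lcmDeg_dehomogenize_le {F : MvPolynomial (Fin n ⊕ Fin u) K} {b : Fin u →₀ ℕ}
    (hF : IsWeightedHomogeneous (fun j => Finsupp.single (extDeg d j) 1) F b) :
    lcmDeg d (dehomogenize K n u F) ≤ b := by
  have : dehomogenize K n u F ∈ restrictSupport K {a | Finsupp.weight (varDeg d) a ≤ b} := by
    conv_rhs => rw [F.as_sum, map_sum]
    refine Submodule.sum_mem _ fun m hm => ?_
    have h := hF (mem_support_iff.1 hm)
    obtain ⟨a, e, rfl⟩ := exists_eq_sumElim m
    rw [weight_single, mapDomain_sumElim] at h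
    rw [dehomogenize_monomial, monomial_mem_restrictSupport]
    left
    change Finsupp.weight (fun j => Finsupp.single (d j) 1) a ≤ b
    rw [weight_single, ← h]
    exact le_self_add
  exact Finset.sup_le fun a ha => this ha

/-- A multihomogeneous element of `S` is a monomial times the homogenization of its
dehomogenization. -/
lemma mem_homIdeal (I : Ideal (MvPolynomial (Fin n) K)) {F : MvPolynomial (Fin n ⊕ Fin u) K}
    {b : Fin u →₀ ℕ}
    (hF : IsWeightedHomogeneous (fun j => Finsupp.single (extDeg d j) 1) F b)
    (hI : dehomogenize K n u F ∈ I) : F ∈ homIdeal d I := by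
  rw [← homogenizeTo_dehomogenize d hF]
  have hle := lcmDeg_dehomogenize_le d hF
  set f := dehomogenize K n u F
  by_cases hf : f = 0
  · rw [hf, map_zero]; exact Ideal.zero_mem _
  have : homogenizeTo d b f = monomial ((0 : Fin n →₀ ℕ).sumElim (b - lcmDeg d f)) 1 *
      homogenize d f := by
    rw [homogenizeTo_apply, homogenize_eq, Finset.mul_sum]
    refine Finset.sum_congr rfl fun a ha => ?_
    rw [monomial_mul, one_mul]
    have := mapDomain_le_lcmDeg d f ha
    refine congrArg (fun m => monomial m (coeff a f)) ?_
    ext (i | i)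
    · simp
    · have h1 := this i
      have h2 := hle i
      simp only [Finsupp.sumElim_inr, Finsupp.add_apply, Finsupp.tsub_apply]
      omega
  rw [this]
  exact Ideal.mul_mem_left _ _ (Ideal.subset_span ⟨f, hI, hf, rfl⟩)

variable (V : Submodule K (MvPolynomial (Fin n) K))

/-- The linear combination of the variables `y_i` with given coefficients. -/
def yForm (K : Type*) [Field K] (n u : ℕ) :
    (Fin u → K) →ₗ[K] MvPolynomial (Fin n ⊕ Fin u) K :=
  Fintype.linearCombination K fun i => X (Sum.inr i)

/-- The space of linear forms of `S` spanned by `V` and the differences `y_i - y_j`. -/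
def extSpace : Submodule K (MvPolynomial (Fin n ⊕ Fin u) K) :=
  V.map (rename Sum.inl).toLinearMap ⊔
    (LinearMap.ker (∑ i : Fin u, LinearMap.proj (R := K) (φ := fun _ => K) i)).map (yForm K n u)

lemma yForm_apply (c : Fin u → K) : yForm K n u c = ∑ i, c i • X (Sum.inr i) := rfl

lemma extSpace_le (hV : V ≤ homogeneousSubmodule (Fin n) K 1) :
    extSpace (u := u) V ≤ homogeneousSubmodule (Fin n ⊕ Fin u) K 1 := by
  refine sup_le (Submodule.map_le_iff_le_comap.2 fun l hl => (hV hl).rename_isHomogeneous)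
    (Submodule.map_le_iff_le_comap.2 fun c _ => ?_)
  rw [Submodule.mem_comap, yForm_apply]
  exact Submodule.sum_mem _ fun i _ => Submodule.smul_mem _ _ (isHomogeneous_X _ _)

lemma X_sub_X_mem_extSpace (i j : Fin u) :
    (X (Sum.inr i) - X (Sum.inr j) : MvPolynomial (Fin n ⊕ Fin u) K) ∈ extSpace V := by
  refine Submodule.mem_sup_right ⟨Pi.single i 1 - Pi.single j 1, ?_, ?_⟩
  · simp
  · simp [yForm_apply, sub_smul, Finset.sum_sub_distrib, Pi.single_apply, ite_smul]

/-- Once all `y_i` are identified with one element `t`, the homogenization becomes a sum of terms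
`f_k * t ^ (N - k)`, with `f_k` the component of `f` of total degree `k`. Each `f_k` lies in `J(V)`,
which is homogeneous for the total degree. -/
lemma homogenize_mem_span (hV : V ≤ homogeneousSubmodule (Fin n) K 1)
    {f : MvPolynomial (Fin n) K} (hf : f ∈ linIdeal V) :
    homogenize d f ∈ Ideal.span (extSpace (u := u) V : Set (MvPolynomial (Fin n ⊕ Fin u) K)) := by
  classical
  set J := Ideal.span (extSpace (u := u) V : Set (MvPolynomial (Fin n ⊕ Fin u) K))
  -- Any `y_j` serves as common value; if `u = 0` the condition is empty.
  obtain ⟨t, ht⟩ : ∃ t : MvPolynomial (Fin n ⊕ Fin u) K, ∀ i, X (Sum.inr i) - t ∈ J := by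
    by_cases hu : Nonempty (Fin u)
    · obtain ⟨j⟩ := hu
      exact ⟨X (Sum.inr j), fun i => Ideal.subset_span (X_sub_X_mem_extSpace V i j)⟩
    · exact ⟨0, fun i => absurd ⟨i⟩ hu⟩
  let α : MvPolynomial (Fin n) K →+* (MvPolynomial (Fin n ⊕ Fin u) K) ⧸ J :=
    (Ideal.Quotient.mk J).comp (rename Sum.inl).toRingHom
  have hα : ∀ g ∈ linIdeal V, α g = 0 := by
    intro g hg
    refine (Ideal.span_le (I := RingHom.ker α)).2 (fun l hl => ?_) hg
    exact Ideal.Quotient.eq_zero_iff_mem.2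
      (Ideal.subset_span (Submodule.mem_sup_left ⟨l, hl, rfl⟩))
  let _ := gradedAlgebra (σ := Fin n) (R := K)
  have hhom : (linIdeal V).IsHomogeneous (homogeneousSubmodule (Fin n) K) :=
    Ideal.homogeneous_span _ _ fun l hl => ⟨1, hV hl⟩
  have hy : ∀ e : Fin u →₀ ℕ, Ideal.Quotient.mk J (rename Sum.inr (monomial e (1 : K))) =
      Ideal.Quotient.mk J t ^ e.degree := by
    intro e
    rw [monomial_eq, C_1, one_mul, Finsupp.prod, map_prod, map_prod, Finsupp.degree_apply,
      ← Finset.prod_pow_eq_pow_sum]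
    refine Finset.prod_congr rfl fun i _ => ?_
    rw [map_pow, map_pow, rename_X, Ideal.Quotient.eq.2 (ht i)]
  set N := (lcmDeg d f).degree with hN
  have hdeg : ∀ a ∈ f.support, (lcmDeg d f - a.mapDomain d).degree + a.degree = N := by
    intro a ha
    rw [hN, ← Finsupp.degree_mapDomain d a, ← map_add,
      tsub_add_cancel_of_le (mapDomain_le_lcmDeg d f ha)]
  rw [← Ideal.Quotient.eq_zero_iff_mem, homogenize_eq, map_sum]
  have hterm : ∀ a ∈ f.support,
      Ideal.Quotient.mk J (monomial (a.sumElim (lcmDeg d f - a.mapDomain d)) (coeff a f)) =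
        α (monomial a (coeff a f)) * Ideal.Quotient.mk J t ^ (N - a.degree) := by
    intro a ha
    rw [monomial_sumElim, map_mul, hy, ← hdeg a ha, Nat.add_sub_cancel]
    rfl
  rw [Finset.sum_congr rfl hterm, ← Finset.sum_fiberwise_of_maps_to
    (t := f.support.image Finsupp.degree) (g := Finsupp.degree)
    (fun a ha => Finset.mem_image_of_mem _ ha)]
  refine Finset.sum_eq_zero fun k _ => ?_
  have : ∑ a ∈ f.support with a.degree = k,
      α (monomial a (coeff a f)) * Ideal.Quotient.mk J t ^ (N - a.degree) =
        α (homogeneousComponent k f) * Ideal.Quotient.mk J t ^ (N - k) := by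
    rw [homogeneousComponent_apply, map_sum, Finset.sum_mul]
    refine Finset.sum_congr rfl fun a ha => ?_
    rw [(Finset.mem_filter.1 ha).2]
  rw [this, hα _ (homogeneousComponent_mem_of_mem hhom hf k), zero_mul]

/-- Consecutive differences suffice, which is why the bidiagonal `Y_A` captures all the `y_i - y_j`
with `i, j ∈ A`. -/
lemma mem_span_single_sub_single {k : ℕ} (W : Submodule K (Fin k → K))
    (hW : ∀ i j : Fin k, (j : ℕ) = i + 1 → Pi.single i 1 - Pi.single j 1 ∈ W) (c : Fin k → K)
    (hc : ∑ i, c i = 0) : c ∈ W := by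
  cases k with
  | zero => rw [Subsingleton.elim c 0]; exact W.zero_mem
  | succ k =>
    have h : ∀ i : Fin (k + 1), Pi.single i 1 - Pi.single 0 1 ∈ W := by
      intro i
      induction i using Fin.induction with
      | zero => simp
      | succ i ih => simpa using W.sub_mem ih (hW i.castSucc i.succ (by simp))
    have : c = ∑ i, c i • (Pi.single i 1 - Pi.single 0 1) := by
      simp only [smul_sub, Finset.sum_sub_distrib]
      rw [← Finset.sum_smul, hc, zero_smul, sub_zero]
      exact pi_eq_sum_univ' c
    rw [this]
    exact W.sum_mem fun i _ => W.smul_mem _ (h i)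

lemma smul_X_mem_span_matY (A : Finset (Fin u)) (c : Fin A.card → K) (hc : ∑ i, c i = 0) :
    (fun p => c p • (X (Sum.inr (A.orderEmbOfFin rfl p)) : MvPolynomial (Fin n ⊕ Fin u) K)) ∈
      Submodule.span K (Set.range (matY K n A).transpose) := by
  let Φ : (Fin A.card → K) →ₗ[K] Fin A.card → MvPolynomial (Fin n ⊕ Fin u) K :=
    LinearMap.pi fun p => (LinearMap.proj p).smulRight (X (Sum.inr (A.orderEmbOfFin rfl p)))
  refine mem_span_single_sub_single
    ((Submodule.span K (Set.range (matY K n A).transpose)).comap Φ) (fun i j hij => ?_) c hc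
  refine Submodule.subset_span ⟨⟨i, by omega⟩, ?_⟩
  ext1 p
  simp only [Matrix.transpose_apply, matY, Matrix.of_apply, Φ, LinearMap.pi_apply,
    LinearMap.smulRight_apply, LinearMap.proj_apply, Pi.sub_apply, Pi.single_apply, Fin.ext_iff]
  rw [hij]
  split_ifs with h1 h2
  · omega
  · simp
  · simp
  · simp

lemma comp_rename (i : Fin u) {l : MvPolynomial (Fin n) K}
    (hl : l ∈ homogeneousSubmodule (Fin n) K 1) :
    comp (extDeg d) i (rename Sum.inl l) = rename Sum.inl (comp d i l) := by
  rw [homogeneousSubmodule_one_eq_span_X] at hl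
  induction hl using Submodule.span_induction with
  | mem x hx =>
    obtain ⟨j, rfl⟩ := hx
    rw [rename_X, comp_of_mem d (isWeightedHomogeneous_X K _ j),
      comp_of_mem (extDeg d) (isWeightedHomogeneous_X K _ (Sum.inl j))]
    split_ifs <;> simp_all
  | zero => simp
  | add x y _ _ hx hy => simp only [map_add, hx, hy]
  | smul c x _ hx => simp only [map_smul, hx]

lemma comp_yForm (i : Fin u) (c : Fin u → K) :
    comp (extDeg d) i (yForm K n u c) = c i • X (Sum.inr i) := by
  rw [yForm_apply, map_sum, Finset.sum_congr rfl fun j _ => by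
    rw [map_smul, comp_of_mem (extDeg d) (isWeightedHomogeneous_X K _ (Sum.inr j))]]
  rw [Finset.sum_eq_single i]
  · exact congrArg _ (if_pos rfl)
  · intro j _ hj
    exact (congrArg _ (if_neg hj)).trans (smul_zero _)
  · exact fun h => absurd (Finset.mem_univ i) h

/-- The column sum is `l + ∑ γ i • y_i` with `l ∈ V` and `∑ γ i = 0`. Its components outside `A`
vanish, so `l` lies in `V_A` and `γ` is supported on `A`; they yield the `M_A` part and the `Y_A`
part of the column. -/
lemma column_mem_span_matX (hV : V ≤ homogeneousSubmodule (Fin n) K 1) {v : ℕ}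
    (A : Finset (Fin u)) (L : Fin v → MvPolynomial (Fin n) K)
    (hL : Submodule.span K (Set.range L) = subspaceOn d V A)
    (c : Fin A.card → MvPolynomial (Fin n ⊕ Fin u) K)
    (hc : ∀ p, c p ∈ formsOf K (extDeg d) (A.orderEmbOfFin rfl p))
    (hcV : ∑ p, c p ∈ extSpace V) :
    c ∈ Submodule.span K (Set.range (matX d A L).transpose) := by
  obtain ⟨_, ⟨l, hl, rfl⟩, _, ⟨γ, hγ, rfl⟩, hsum⟩ := Submodule.mem_sup.1 hcV
  have hcomp : ∀ i, comp (extDeg d) i (∑ p, c p) =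
      rename Sum.inl (comp d i l) + γ i • X (Sum.inr i) := fun i => by
    rw [← hsum, map_add, comp_yForm]
    congr 1
    exact comp_rename d i (hV hl)
  have hout : ∀ i ∉ A, comp d i l = 0 ∧ γ i = 0 := by
    intro i hi
    have h1 := hcomp i
    rw [comp_sum_columns_of_notMem (extDeg d) A c hc hi] at h1
    -- Putting all `y_i = 0` isolates the part in the `x_j`.
    have h2 : comp d i l = 0 := by
      have := congrArg (aeval (Sum.elim X 0 : Fin n ⊕ Fin u → MvPolynomial (Fin n) K)) h1
      rw [map_zero, map_add, map_smul, aeval_rename, Sum.elim_comp_inl, aeval_X_left_apply,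
        aeval_X] at this
      simpa using this.symm
    refine ⟨h2, ?_⟩
    rw [h2, map_zero, zero_add] at h1
    exact (smul_eq_zero.1 h1.symm).resolve_right (X_ne_zero _)
  have hlA : l ∈ Submodule.span K (Set.range L) := by
    rw [hL]
    refine ⟨hl, ?_⟩
    rw [SetLike.mem_coe, ← sum_comp_of_mem d (hV hl),
      ← Finset.sum_subset (Finset.subset_univ A) fun i _ hi => (hout i hi).1]
    exact Submodule.sum_mem _ fun i hi => Submodule.mem_iSup_of_mem i
      (Submodule.mem_iSup_of_mem hi (weightedHomogeneousComponent_mem _ _ _))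
  have hγA : ∑ p, γ (A.orderEmbOfFin rfl p) = 0 := by
    rw [sum_orderEmbOfFin, Finset.sum_subset (Finset.subset_univ A) fun i _ hi => (hout i hi).2]
    simpa using hγ
  have hdecomp : c = (fun p => rename Sum.inl (comp d (A.orderEmbOfFin rfl p) l)) +
      fun p => γ (A.orderEmbOfFin rfl p) • X (Sum.inr (A.orderEmbOfFin rfl p)) := by
    ext1 q
    rw [← comp_sum_columns (extDeg d) A c hc q, hcomp]
    rfl
  rw [hdecomp]
  refine Submodule.add_mem _ ?_ ?_
  · have h1 := Submodule.mem_map_of_mem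
      (f := LinearMap.compLeft (rename (Sum.inl : Fin n → Fin n ⊕ Fin u) (R := K)).toLinearMap
        (Fin A.card)) (comp_mem_span_columns d A L hlA)
    rw [Submodule.map_span] at h1
    refine Submodule.span_mono ?_ h1
    rintro _ ⟨_, ⟨i, rfl⟩, rfl⟩
    exact ⟨Sum.inr i, rfl⟩
  · refine Submodule.span_mono ?_ (smul_X_mem_span_matY A _ hγA)
    rintro _ ⟨i, rfl⟩
    exact ⟨Sum.inl i, rfl⟩

lemma matX_mem_formsOf {v : ℕ} (A : Finset (Fin u)) (L : Fin v → MvPolynomial (Fin n) K)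
    (p : Fin A.card) (j : Fin (A.card - 1) ⊕ Fin v) :
    matX d A L p j ∈ formsOf K (extDeg d) (A.orderEmbOfFin rfl p) := by
  rcases j with j | j
  · have hX : (X (Sum.inr (A.orderEmbOfFin rfl p)) : MvPolynomial (Fin n ⊕ Fin u) K) ∈
        formsOf K (extDeg d) (A.orderEmbOfFin rfl p) :=
      isWeightedHomogeneous_X K _ _
    change matY K n A p j ∈ _
    simp only [matY, Matrix.of_apply]
    split_ifs
    · exact hX
    · exact Submodule.neg_mem _ hX
    · exact Submodule.zero_mem _
  · change rename Sum.inl (comp d (A.orderEmbOfFin rfl p) (L j)) ∈ _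
    set g := comp d (A.orderEmbOfFin rfl p) (L j)
    have hg : g ∈ formsOf K d (A.orderEmbOfFin rfl p) := weightedHomogeneousComponent_mem _ _ _
    rw [← comp_of_mem d hg (A.orderEmbOfFin rfl p) |>.trans (if_pos rfl),
      ← comp_rename d _ (formsOf_le d _ hg)]
    exact weightedHomogeneousComponent_mem _ _ _

/-- At `y = 1` each column of `Y_A` becomes `1, -1` and sums to zero, while a column of `M_A` sums
to some `L i`. -/
lemma sum_dehomogenize_matX_mem {v : ℕ} (A : Finset (Fin u))
    (L : Fin v → MvPolynomial (Fin n) K) (hL : ∀ i, L i ∈ subspaceOn d V A)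
    (r : Fin A.card ↪ Fin A.card) (j : Fin (A.card - 1) ⊕ Fin v) :
    ∑ p, dehomogenize K n u (matX d A L (r p) j) ∈ V := by
  rcases j with j | j
  · have hr : Function.Bijective r := Finite.injective_iff_bijective.1 r.injective
    rw [hr.sum_comp (fun p => dehomogenize K n u (matX d A L p (Sum.inl j)))]
    have h1 : ∀ p : Fin A.card, dehomogenize K n u (matX d A L p (Sum.inl j)) =
        (if p = ⟨j, by omega⟩ then 1 else 0) - (if p = ⟨j + 1, by omega⟩ then 1 else 0) := by
      intro p
      change dehomogenize K n u (matY K n A p j) = _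
      simp only [matY, Matrix.of_apply, Fin.ext_iff, dehomogenize]
      split_ifs with h1 h2
      · omega
      · simp
      · simp
      · simp
    rw [Finset.sum_congr rfl fun p _ => h1 p]
    simp
  · have h1 : ∀ p, dehomogenize K n u (matX d A L (r p) (Sum.inr j)) = matM d A L (r p) j := by
      intro p
      change dehomogenize K n u (rename Sum.inl (matM d A L (r p) j)) = _
      rw [dehomogenize, aeval_rename, Sum.elim_comp_inl, aeval_X_left_apply]
    rw [Finset.sum_congr rfl fun p _ => h1 p]
    exact sum_matM_mem d V A L hL r j

lemma homIdeal_eq (hV : V ≤ homogeneousSubmodule (Fin n) K 1) (v : Finset (Fin u) → ℕ)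
    (L : (A : Finset (Fin u)) → Fin (v A) → MvPolynomial (Fin n) K)
    (hL : ∀ A : Finset (Fin u), A.Nonempty →
      Submodule.span K (Set.range (L A)) = subspaceOn d V A) :
    homIdeal d (linIdeal V) =
      ∑ A : Finset (Fin u) with A.Nonempty, minorIdeal A.card (matX d A (L A)) := by
  apply le_antisymm
  · refine Ideal.span_le.2 ?_
    rintro _ ⟨f, hf, -, rfl⟩
    refine detIdeal_le_sum_minorIdeal (extDeg d) (extSpace V) (fun A => matX d A (L A))
      (fun A hA c hc hcV => ?_) (mem_detIdeal (extDeg d) _ (extSpace_le V hV)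
        (homogenize_isWeightedHomogeneous d f) (homogenize_mem_span d V hV hf))
    exact Submodule.span_le_restrictScalars K (MvPolynomial (Fin n ⊕ Fin u) K) _
      (column_mem_span_matX d V hV A (L A) (hL A hA) c hc hcV)
  · rw [Ideal.sum_eq_sup]
    refine Finset.sup_le fun A hA => Ideal.span_le.2 ?_
    have hA : A.Nonempty := (Finset.mem_filter.1 hA).2
    rintro _ ⟨r, c, rfl⟩
    have : NeZero A.card := ⟨hA.card_pos.ne'⟩
    refine mem_homIdeal d _ (det_isWeightedHomogeneous (extDeg d)
      (fun p => A.orderEmbOfFin rfl (r p)) _ fun p j => matX_mem_formsOf d A (L A) _ _) ?_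
    rw [AlgHom.map_det]
    refine det_mem_of_sum_mem _ _ fun j => Ideal.subset_span
      (sum_dehomogenize_matX_mem d V A (L A) (fun i => ?_) r (c j))
    rw [← hL A hA]
    exact Submodule.subset_span ⟨i, rfl⟩

end

end MultiHom

end

/-- For each nonempty `A`, `L A` is an arbitrary finite generating family of `V_A`, from which the
matrices `X_A` and `M_A` are built. -/
theorem theorem3p4 {K : Type*} [Field K] {n u : ℕ} (d : Fin n → Fin u)
    (V : Submodule K (MvPolynomial (Fin n) K))
    (hV : V ≤ MvPolynomial.homogeneousSubmodule (Fin n) K 1)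
    (v : Finset (Fin u) → ℕ)
    (L : (A : Finset (Fin u)) → Fin (v A) → MvPolynomial (Fin n) K)
    (hL : ∀ A : Finset (Fin u), A.Nonempty →
      Submodule.span K (Set.range (L A)) = MultiHom.subspaceOn d V A) :
    MultiHom.homIdeal d (MultiHom.linIdeal V) =
        ∑ A : Finset (Fin u) with A.Nonempty,
          MultiHom.minorIdeal A.card (MultiHom.matX d A (L A)) ∧
      MultiHom.starIdeal d (MultiHom.linIdeal V) =
        ∑ A : Finset (Fin u) with A.Nonempty,
          MultiHom.minorIdeal A.card (MultiHom.matM d A (L A)) :=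
  ⟨MultiHom.homIdeal_eq d V hV v L hL, MultiHom.starIdeal_eq d V hV v L hL⟩
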